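/- **Data.** Fix dimensions $n_x,n_u,n_F,n_H$, a horizon $N$, a measured state $x_k\in\mathbb R^{n_x}$, a differentiable map $f_d:\mathbb R^{n_x}\times\mathbb R^{n_u}\to\mathbb R^{n_x}$, square matrices $Q,Q_f\in\mathbb R^{n_x\times n_x}$, $R\in\mathbb R^{n_u\times n_u}$ (with $\|x\|_Q^2:=x^\top Qx$, etc.), constraint data $F\in\mathbb R^{n_F\times n_x}$, $f\in\mathbb R^{n_F}$ with rows $[F]_n$ and entries $[f]_n$, a polyhedron $\mathbb W=\{w\in\mathbb R^{n_x}: Hw\le h\}$ with $H\in\mathbb R^{n_H\times n_x}$, a norm $\|\cdot\|$ on $\mathbb R^{n_x}$ with dual norm $\|y\|_*=\sup_{\|x\|\le1}y^\top x$, a radius $\varepsilon>0$, and for each step $m=0,\dots,N-1$ samples $\hat w_m^{(1)},\dots,\hat w_m^{(M)}\in\mathbb W$, $M\ge1$ (possibly the same samples at every step). Let $\mathcal P_m$ be the set of Borel probability measures $\mathbb Q$ supported on $\mathbb W$ with finite first moment whose type-1 Wasserstein distance (with respect to $\|\cdot\|$) from $\frac1M\sum_{l=1}^M\delta_{\hat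 w_m^{(l)}}$ is at most $\varepsilon$. For $\mathbf z=(z_0,\dots,z_N)$, $\mathbf v=(v_0,\dots,v_{N-1})$, $\mathbf K=(K_0,\dots,K_{N-1})$, $\mathbf c=(c_0,\dots,c_{N-1})$ with $z_i\in\mathbb R^{n_x}$, $v_i,c_i\in\mathbb R^{n_u}$, $K_i\in\mathbb R^{n_u\times n_x}$, put $$A_{cl,i}=\tfrac{\partial f_d}{\partial x}(z_i,v_i)+\tfrac{\partial f_d}{\partial u}(z_i,v_i)K_i,\qquad \Phi_{i,m}=\prod_{j=0}^{i-1-m}A_{cl,i-1-j}^{\min\{1,\,i-1-m-j\}}=A_{cl,i-1}\cdots A_{cl,m+1}\quad(0\le m<i\le N),$$ so $\Phi_{i,i-1}=I$, and $J(\mathbf z,\mathbf v)=\sum_{i=0}^{N-1}(\|z_i\|_Q^2+\|v_i\|_R^2)+\|z_N\|_{Q_f}^2$. The nominal constraints are $z_0=x_k$, $z_{i+1}=f_d(z_i,v_i)$ and $v_i=K_iz_i+c_i$ for $0\le i<N$. **Problem (A).** Minimize $J$ over $(\mathbf z,\mathbf v,\mathbf K,\mathbf c)$ subject to the nominal constraints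 and, for all $1\le i\le N$ and $1\le n\le n_F$, $$\sup_{\mathbb P_m\in\mathcal P_m,\ m=0,\dots,i-1}\ \mathbb E_{\mathbb P_0\times\cdots\times\mathbb P_{i-1}}\Big\{[F]_n\Big(z_i+\sum_{m=0}^{i-1}\Phi_{i,m}W_m\Big)\Big\}\le[f]_n .$$ **Problem (B).** Minimize $J$ over $(\mathbf z,\mathbf v,\mathbf K,\mathbf c)$ and, for all $1\le i\le N$, $1\le n\le n_F$, $0\le m<i$, $1\le l\le M$, variables $\lambda^{i,n}_m,s^{i,n}_{ml}\in\mathbb R$, $\gamma^{i,n}_{ml}\in\mathbb R^{n_H}$, subject to the nominal constraints and, for all such $i,n,m,l$, $$\sum_{m=0}^{i-1}\Big(\lambda^{i,n}_m\varepsilon+\frac1M\sum_{l=1}^Ms^{i,n}_{ml}\Big)\le[f]_n-[F]_nz_i,$$ $$[F]_n\Phi_{i,m}\hat w_m^{(l)}+(\gamma^{i,n}_{ml})^\top(h-H\hat w_m^{(l)})\le s^{i,n}_{ml},\qquad \big\|H^\top\gamma^{i,n}_{ml}-([F]_n\Phi_{i,m})^\top\big\|_*\le\lambda^{i,n}_m,\qquad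 \gamma^{i,n}_{ml}\ge0 .$$ **Claim.** The two problems are equivalent: (1) the feasible set of (A) is exactly the projection of the feasible set of (B) onto $(\mathbf z,\mathbf v,\mathbf K,\mathbf c)$; (2) the optimal values in $[-\infty,\infty]$ coincide; (3) $(\mathbf z,\mathbf v,\mathbf K,\mathbf c)$ is optimal for (A) if and only if it can be completed by some $(\lambda,s,\gamma)$ to an optimal solution of (B); (4) a point of (B) is optimal for (B) if and only if it is feasible for (B) and its $(\mathbf z,\mathbf v,\mathbf K,\mathbf c)$-part is optimal for (A). -/

import Mathlib

open MeasureTheory Matrix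
open scoped ENNReal

namespace DRMPC

/-! ### Wasserstein ambiguity sets -/

/-- The polyhedron `{w | H w ≤ h}` (componentwise inequality). -/
def polyhedron {n nH : ℕ} (H : Matrix (Fin nH) (Fin n) ℝ) (h : Fin nH → ℝ) : Set (Fin n → ℝ) :=
  {w | H *ᵥ w ≤ h}

/-- The dual norm `‖y‖_* = sup {⟨y, x⟩ | ‖x‖ ≤ 1}` of a norm `p` on `ℝⁿ`. -/
noncomputable def dualNorm {n : ℕ} (p : Seminorm ℝ (Fin n → ℝ)) (y : Fin n → ℝ) : ℝ :=
  sSup {r : ℝ | ∃ x : Fin n → ℝ, p x ≤ 1 ∧ r = y ⬝ᵥ x}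

/-- `π` is a joint distribution with marginals `μ` and `ν`. -/
def IsCoupling {n : ℕ} (π : Measure ((Fin n → ℝ) × (Fin n → ℝ))) (μ ν : Measure (Fin n → ℝ)) :
    Prop :=
  π.map Prod.fst = μ ∧ π.map Prod.snd = ν

/-- The Wasserstein distance of order one with respect to the norm `p`. -/
noncomputable def wasserstein {n : ℕ} (p : Seminorm ℝ (Fin n → ℝ)) (μ ν : Measure (Fin n → ℝ)) :
    ℝ≥0∞ :=
  ⨅ (π : Measure ((Fin n → ℝ) × (Fin n → ℝ))) (_ : IsCoupling π μ ν),
    ∫⁻ ξ, ENNReal.ofReal (p (ξ.1 - ξ.2)) ∂π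

/-- The empirical distribution `(1/M) ∑ₗ δ_{ŵₗ}`. -/
noncomputable def empirical {n M : ℕ} (w : Fin M → Fin n → ℝ) : Measure (Fin n → ℝ) :=
  (M : ℝ≥0∞)⁻¹ • ∑ l : Fin M, Measure.dirac (w l)

/-- The Wasserstein ball: probability distributions supported on `W`, with finite first moment,
at distance at most `ε` from the centre. -/
def wassersteinBall {n : ℕ} (p : Seminorm ℝ (Fin n → ℝ)) (W : Set (Fin n → ℝ))
    (center : Measure (Fin n → ℝ)) (ε : ℝ) : Set (ProbabilityMeasure (Fin n → ℝ)) :=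
  {Q | (Q : Measure (Fin n → ℝ)) Wᶜ = 0 ∧
    ∫⁻ ξ, ENNReal.ofReal (p ξ) ∂(Q : Measure (Fin n → ℝ)) < ∞ ∧
    wasserstein p center (Q : Measure (Fin n → ℝ)) ≤ ENNReal.ofReal ε}

/-! ### Optimization problems -/

/-- The optimal value `inf {J x | x ∈ S}` in the extended reals. -/
noncomputable def optimalValue {α : Type*} (S : Set α) (J : α → ℝ) : EReal :=
  ⨅ x ∈ S, (J x : EReal)

/-- `x` is an optimal solution of `min J` over `S`. -/
def IsOptimal {α : Type*} (S : Set α) (J : α → ℝ) (x : α) : Prop :=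
  x ∈ S ∧ ∀ y ∈ S, J x ≤ J y

/-! ### The control problem -/

/-- The data of the control problem at a fixed sampling time: state dimension `nx`, input
dimension `nu`, `nF` state constraints `F x ≤ f`, disturbance support described by `nH`
inequalities `H w ≤ h`, prediction horizon `N` and `M` disturbance samples. -/
structure Data (nx nu nF nH N M : ℕ) where
  /-- the discrete-time dynamics `f_d` -/
  dyn : (Fin nx → ℝ) → (Fin nu → ℝ) → (Fin nx → ℝ)
  /-- the measured state `x_k` -/
  x₀ : Fin nx → ℝ
  /-- state penalty -/
  Q : Matrix (Fin nx) (Fin nx) ℝ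
  /-- input penalty -/
  R : Matrix (Fin nu) (Fin nu) ℝ
  /-- terminal penalty -/
  Qf : Matrix (Fin nx) (Fin nx) ℝ
  /-- constraint matrix -/
  F : Matrix (Fin nF) (Fin nx) ℝ
  /-- constraint right-hand side -/
  f : Fin nF → ℝ
  /-- matrix of the disturbance support -/
  H : Matrix (Fin nH) (Fin nx) ℝ
  /-- right-hand side of the disturbance support -/
  h : Fin nH → ℝ
  /-- the norm in the Wasserstein distance -/
  nrm : Seminorm ℝ (Fin nx → ℝ)
  /-- the radius of the Wasserstein balls -/
  ε : ℝ
  /-- `sample m l` is the `l`-th disturbance sample used at prediction step `m` -/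
  sample : Fin N → Fin M → Fin nx → ℝ

/-- The decision variables of the linearized problem: nominal states `z₀, …, z_N`, nominal inputs
`v₀, …, v_{N-1}`, feedback gains `K₀, …, K_{N-1}` and feedforward terms `c₀, …, c_{N-1}`. -/
structure Plan (nx nu N : ℕ) where
  z : Fin (N + 1) → Fin nx → ℝ
  v : Fin N → Fin nu → ℝ
  K : Fin N → Matrix (Fin nu) (Fin nx) ℝ
  c : Fin N → Fin nu → ℝ

/-- The additional, finitely many real variables of the reformulation. The index `i : Fin N` stands
for the prediction step `i + 1`, whose predicted state is affected by the disturbances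
`W₀, …, W_i`, so `m : Fin (i + 1)`; `n` is the row of the state constraint and `l` the sample. -/
structure Duals (nF nH N M : ℕ) where
  lam : (i : Fin N) → Fin nF → Fin (i.val + 1) → ℝ
  s : (i : Fin N) → Fin nF → Fin (i.val + 1) → Fin M → ℝ
  γ : (i : Fin N) → Fin nF → Fin (i.val + 1) → Fin M → Fin nH → ℝ

variable {nx nu nF nH N M : ℕ}

namespace Data

/-- `A(z, v) = ∂f_d/∂x (z, v)`. -/
noncomputable def jacX (D : Data nx nu nF nH N M) (z : Fin nx → ℝ) (v : Fin nu → ℝ) :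
    Matrix (Fin nx) (Fin nx) ℝ :=
  LinearMap.toMatrix' (fderiv ℝ (fun x => D.dyn x v) z : (Fin nx → ℝ) →ₗ[ℝ] (Fin nx → ℝ))

/-- `B(z, v) = ∂f_d/∂u (z, v)`. -/
noncomputable def jacU (D : Data nx nu nF nH N M) (z : Fin nx → ℝ) (v : Fin nu → ℝ) :
    Matrix (Fin nx) (Fin nu) ℝ :=
  LinearMap.toMatrix' (fderiv ℝ (fun u => D.dyn z u) v : (Fin nu → ℝ) →ₗ[ℝ] (Fin nx → ℝ))

/-- The closed-loop matrix `A_{cl,i} = A(z_i, v_i) + B(z_i, v_i) K_i`. -/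
noncomputable def closedLoop (D : Data nx nu nF nH N M) (P : Plan nx nu N) (i : Fin N) :
    Matrix (Fin nx) (Fin nx) ℝ :=
  D.jacX (P.z i.castSucc) (P.v i) + D.jacU (P.z i.castSucc) (P.v i) * P.K i

/-- The closed-loop transition product from the disturbance `W_m` to the state at step `i + 1`:
the ordered product `∏_{j=0}^{i-m} A_{cl,i-j} ^ min {1, i-m-j} = A_{cl,i} ⋯ A_{cl,m+1} I`. -/
noncomputable def transition (D : Data nx nu nF nH N M) (P : Plan nx nu N) (i : Fin N)
    (m : Fin (i.val + 1)) : Matrix (Fin nx) (Fin nx) ℝ :=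
  (List.ofFn fun j : Fin (i.val - m.val + 1) =>
    D.closedLoop P ⟨i.val - j.val, lt_of_le_of_lt (Nat.sub_le _ _) i.isLt⟩ ^
      min 1 (i.val - m.val - j.val)).prod

/-- The disturbance samples used at step `m`, for `m` below the prediction step `i + 1`. -/
def sampleAt (D : Data nx nu nF nH N M) (i : Fin N) (m : Fin (i.val + 1)) :
    Fin M → Fin nx → ℝ :=
  D.sample ⟨m.val, lt_of_lt_of_le m.isLt i.isLt⟩

/-- The ambiguity set of the disturbance `W_m`, for `m` below the prediction step `i + 1`. -/
noncomputable def ambiguity (D : Data nx nu nF nH N M) (i : Fin N) (m : Fin (i.val + 1)) :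
    Set (ProbabilityMeasure (Fin nx → ℝ)) :=
  wassersteinBall D.nrm (polyhedron D.H D.h) (empirical (D.sampleAt i m)) D.ε

/-- `∑_{i<N} (‖z_i‖_Q² + ‖v_i‖_R²) + ‖z_N‖_{Qf}²`. -/
def cost (D : Data nx nu nF nH N M) (P : Plan nx nu N) : ℝ :=
  (∑ i : Fin N, (P.z i.castSucc ⬝ᵥ (D.Q *ᵥ P.z i.castSucc) + P.v i ⬝ᵥ (D.R *ᵥ P.v i))) +
    P.z (Fin.last N) ⬝ᵥ (D.Qf *ᵥ P.z (Fin.last N))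

/-- The nominal constraints: initial state, nominal dynamics and nominal policy. -/
def Nominal (D : Data nx nu nF nH N M) (P : Plan nx nu N) : Prop :=
  P.z 0 = D.x₀ ∧
  (∀ i : Fin N, P.z i.succ = D.dyn (P.z i.castSucc) (P.v i)) ∧
  (∀ i : Fin N, P.v i = P.K i *ᵥ P.z i.castSucc + P.c i)

/-- The worst-case expectation of `[F]_n (z_{i+1} + ∑_{m ≤ i} Φ_{i,m} W_m)` over all product
distributions with independent `W_m ∼ P_m`, each `P_m` in its ambiguity set. -/
noncomputable def worstCase (D : Data nx nu nF nH N M) (P : Plan nx nu N) (i : Fin N)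
    (n : Fin nF) : EReal :=
  ⨆ (ℙ : Fin (i.val + 1) → ProbabilityMeasure (Fin nx → ℝ)) (_ : ∀ m, ℙ m ∈ D.ambiguity i m),
    ((∫ W : Fin (i.val + 1) → Fin nx → ℝ,
        D.F n ⬝ᵥ (P.z i.succ + ∑ m, D.transition P i m *ᵥ W m)
        ∂(Measure.pi fun m => (ℙ m : Measure (Fin nx → ℝ))) : ℝ) : EReal)

/-- The feasible set of the linearized distributionally robust problem. -/
def feasible (D : Data nx nu nF nH N M) : Set (Plan nx nu N) :=
  {P | D.Nominal P ∧ ∀ (i : Fin N) (n : Fin nF), D.worstCase P i n ≤ (D.f n : EReal)}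

/-- The feasible set of the finite-dimensional reformulation. -/
def reformulated (D : Data nx nu nF nH N M) : Set (Plan nx nu N × Duals nF nH N M) :=
  {X | D.Nominal X.1 ∧ ∀ (i : Fin N) (n : Fin nF),
    (∑ m, (X.2.lam i n m * D.ε + (1 / (M : ℝ)) * ∑ l, X.2.s i n m l)
      ≤ D.f n - D.F n ⬝ᵥ X.1.z i.succ) ∧
    ∀ (m : Fin (i.val + 1)) (l : Fin M),
      (D.F n ᵥ* D.transition X.1 i m) ⬝ᵥ D.sampleAt i m l
          + X.2.γ i n m l ⬝ᵥ (D.h - D.H *ᵥ D.sampleAt i m l) ≤ X.2.s i n m l ∧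
      dualNorm D.nrm (D.Hᵀ *ᵥ X.2.γ i n m l - D.F n ᵥ* D.transition X.1 i m)
        ≤ X.2.lam i n m ∧
      0 ≤ X.2.γ i n m l}

end Data

end DRMPC

namespace DRMPC

/-! The predicted state is affine in independent disturbances, so its expectation depends only on
the marginals, and the worst case splits into one problem per step `m`: maximize the mean of `a ⬝ᵥ
w`, with `a = D.F k ᵥ* D.transition P i m`, over a Wasserstein ball. What has to be shown is that
each such problem has an exact dual with attained optimum; attainment matters because the feasible
sets must agree exactly.

Weak duality: dual feasibility gives `a ⬝ᵥ w ≤ s l + r * p (ŵ l - w)` on the polyhedron, and this is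
integrated against nearly optimal couplings (`integral_le_of_mem_wassersteinBall`).

Strong duality: it suffices to test distributions that move each sample to a single point, which
leaves a finite-dimensional convex program (`exists_dual_of_transport_le`). Since `ε > 0`, leaving
the samples in place is a Slater point, which yields the multiplier `r`. The Lagrangian then
separates over samples, giving the `s l`, and polyhedral duality gives each `γ l`
(`exists_multiplier_of_polyhedron`); attainment there rests on closedness of finitely generated
cones.

The cost ignores the dual variables, so all claims about optimal values and solutions follow from
the projection identity. -/

/-! ### Finitely generated cones -/

/-- If the generators are linearly dependent, every conic combination omits one of them. -/
theorem exists_conic_combination_erase {ι E : Type*} [DecidableEq ι] [AddCommGroup E] [Module ℝ E]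
    {v : ι → E} {s : Finset ι} {g : ι → ℝ} (hg : ∑ i ∈ s, g i • v i = 0)
    {j : ι} (hj : j ∈ s) (hgj : 0 < g j) {c : ι → ℝ} (hc : ∀ i, 0 ≤ c i) :
    ∃ k ∈ s, ∃ c' : ι → ℝ, (∀ i, 0 ≤ c' i) ∧
      ∑ i ∈ s, c i • v i = ∑ i ∈ s.erase k, c' i • v i := by
  -- Ratio test, as in Carathéodory's theorem: subtracting `c k / g k` times the relation cancels
  -- the coefficient of `k`, and minimality of the ratio keeps the others nonnegative.
  obtain ⟨k, hk, hmin⟩ := (s.filter fun i => 0 < g i).exists_min_image (fun i => c i / g i)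
    ⟨j, by simp [hj, hgj]⟩
  simp only [Finset.mem_filter] at hk hmin
  have ht : 0 ≤ c k / g k := div_nonneg (hc k) hk.2.le
  refine ⟨k, hk.1, fun i => if i ∈ s then c i - c k / g k * g i else 0, fun i => ?_, ?_⟩
  · dsimp only
    split_ifs with hi
    · rcases le_or_gt (g i) 0 with h | h
      · nlinarith [hc i, mul_nonneg ht (neg_nonneg.2 h)]
      · have := hmin i ⟨hi, h⟩
        rw [le_div_iff₀ h] at this
        linarith
    · exact le_rfl
  · have hzero : c k - c k / g k * g k = 0 := by
      rw [div_mul_cancel₀ _ hk.2.ne', sub_self]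
    rw [Finset.sum_erase _ (by simp [hzero])]
    have : ∑ i ∈ s, (if i ∈ s then c i - c k / g k * g i else 0) • v i
        = ∑ i ∈ s, (c i • v i - (c k / g k) • (g i • v i)) :=
      Finset.sum_congr rfl fun i hi => by rw [if_pos hi, sub_smul, mul_smul]
    rw [this, Finset.sum_sub_distrib, ← Finset.smul_sum, hg, smul_zero, sub_zero]

/-- A finitely generated cone in a finite-dimensional space is closed. -/
theorem isClosed_conic_combinations {ι E : Type*} [NormedAddCommGroup E] [NormedSpace ℝ E]
    [FiniteDimensional ℝ E] (v : ι → E) (s : Finset ι) :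
    IsClosed {x | ∃ c : ι → ℝ, (∀ i, 0 ≤ c i) ∧ x = ∑ i ∈ s, c i • v i} := by
  classical
  induction s using Finset.strongInduction with
  | H s ih =>
    -- Independent generators: the cone is the image of an orthant under a closed embedding.
    -- Dependent generators: it is a finite union of cones with one generator fewer.
    by_cases hli : LinearIndepOn ℝ v (s : Set ι)
    · have hinj : Function.Injective (Fintype.linearCombination ℝ fun i : s => v i) :=
        LinearIndependent.fintypeLinearCombination_injective hli
      have hemb := LinearMap.isClosedEmbedding_of_injective
        (f := Fintype.linearCombination ℝ fun i : s => v i) (LinearMap.ker_eq_bot.2 hinj)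
      convert hemb.isClosedMap _ (isClosed_Ici (a := (0 : s → ℝ))) using 1
      ext x
      constructor
      · rintro ⟨c, hc, rfl⟩
        refine ⟨fun i => c i, fun i => hc i, ?_⟩
        rw [Fintype.linearCombination_apply]
        exact Finset.sum_coe_sort s fun i => c i • v i
      · rintro ⟨c, hc, rfl⟩
        refine ⟨fun i => if h : i ∈ s then c ⟨i, h⟩ else 0, fun i => ?_, ?_⟩
        · dsimp only
          split_ifs
          exacts [hc _, le_rfl]
        · rw [Fintype.linearCombination_apply, ← Finset.sum_coe_sort s]
          exact Finset.sum_congr rfl fun i _ => by simp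
    · have hdep : ∃ g : ι → ℝ, ∑ i ∈ s, g i • v i = 0 ∧ ∃ j ∈ s, 0 < g j := by
        rw [linearIndepOn_finset_iff] at hli
        push Not at hli
        obtain ⟨g, hg, j, hj, hgj⟩ := hli
        rcases lt_or_gt_of_ne hgj with h | h
        · refine ⟨-g, ?_, j, hj, by simpa using h⟩
          simp [Finset.sum_neg_distrib, hg]
        · exact ⟨g, hg, j, hj, h⟩
      obtain ⟨g, hg, j, hj, hgj⟩ := hdep
      have heq : {x | ∃ c : ι → ℝ, (∀ i, 0 ≤ c i) ∧ x = ∑ i ∈ s, c i • v i}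
          = ⋃ k ∈ s, {x | ∃ c : ι → ℝ, (∀ i, 0 ≤ c i) ∧ x = ∑ i ∈ s.erase k, c i • v i} := by
        ext x
        simp only [Set.mem_iUnion, Set.mem_ofPred_eq, exists_prop]
        constructor
        · rintro ⟨c, hc, rfl⟩
          exact exists_conic_combination_erase hg hj hgj hc
        · rintro ⟨k, hk, c, hc, rfl⟩
          refine ⟨fun i => if i = k then 0 else c i, fun i => ?_, ?_⟩
          · dsimp only
            split_ifs
            exacts [le_rfl, hc i]
          · rw [← Finset.sum_erase s (a := k) (by simp)]
            exact Finset.sum_congr rfl fun i hi => by simp [Finset.ne_of_mem_erase hi]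
      rw [heq]
      exact s.finite_toSet.isClosed_biUnion fun k hk => ih _ (Finset.erase_ssubset hk)

/-! ### Norms and dual norms -/

variable {n nH M : ℕ}

theorem le_sum_abs_mul (p : Seminorm ℝ (Fin n → ℝ)) (x : Fin n → ℝ) :
    p x ≤ ∑ i, |x i| * p (Pi.single i 1) := by
  calc p x = p (∑ i, x i • Pi.single i (1 : ℝ)) := by
        congr 1; ext j; simp [Finset.sum_apply, Pi.single_apply]
    _ ≤ ∑ i, p (x i • Pi.single i (1 : ℝ)) :=
        Finset.le_sum_of_subadditive p (map_zero p).le (map_add_le_add p) _ _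
    _ = _ := by simp [map_smul_eq_mul]

theorem seminorm_continuous (p : Seminorm ℝ (Fin n → ℝ)) : Continuous p := by
  have hC : ∀ x, p x ≤ (∑ i, p (Pi.single i 1)) * ‖x‖ := fun x => by
    refine (le_sum_abs_mul p x).trans ?_
    rw [Finset.sum_mul]
    refine Finset.sum_le_sum fun i _ => ?_
    rw [mul_comm]
    exact mul_le_mul_of_nonneg_left (norm_le_pi_norm x i) (apply_nonneg p _)
  refine continuous_iff_continuousAt.2 fun x => ?_
  rw [ContinuousAt, tendsto_iff_norm_sub_tendsto_zero]
  have hlim : Filter.Tendsto (fun y => (∑ i, p (Pi.single i 1)) * ‖y - x‖) (nhds x) (nhds 0) := by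
    have : Continuous fun y : Fin n → ℝ => (∑ i, p (Pi.single i 1)) * ‖y - x‖ := by fun_prop
    simpa using this.tendsto x
  refine squeeze_zero (fun _ => norm_nonneg _) (fun y => ?_) hlim
  exact (abs_sub_map_le_sub p y x).trans (hC _)

/-- A norm on `ℝⁿ` dominates the supremum norm. -/
theorem exists_norm_le_mul (p : Seminorm ℝ (Fin n → ℝ)) (hp : ∀ x, p x = 0 → x = 0) :
    ∃ C : ℝ, 0 ≤ C ∧ ∀ x, ‖x‖ ≤ C * p x := by
  -- The sphere is empty when `n = 0`; otherwise the constant is the inverse of the minimum of `p`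
  -- on the sphere, positive by definiteness.
  rcases (Metric.sphere (0 : Fin n → ℝ) 1).eq_empty_or_nonempty with he | hne
  · refine ⟨0, le_rfl, fun x => ?_⟩
    have : x = 0 := by
      by_contra hx
      have : ‖x‖⁻¹ • x ∈ Metric.sphere (0 : Fin n → ℝ) 1 := by
        simp [norm_smul, norm_ne_zero_iff.2 hx]
      simp [he] at this
    simp [this]
  · obtain ⟨y, hy, hmin⟩ := (isCompact_sphere (0 : Fin n → ℝ) 1).exists_isMinOn hne
      (seminorm_continuous p).continuousOn
    have hpy : 0 < p y := by
      refine lt_of_le_of_ne (apply_nonneg p y) fun h => ?_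
      rw [hp y h.symm] at hy
      simp at hy
    refine ⟨(p y)⁻¹, inv_nonneg.2 hpy.le, fun x => ?_⟩
    rcases eq_or_ne x 0 with rfl | hx
    · simp
    have hxn : 0 < ‖x‖ := norm_pos_iff.2 hx
    have hmem : ‖x‖⁻¹ • x ∈ Metric.sphere (0 : Fin n → ℝ) 1 := by
      simp [norm_smul, hxn.ne']
    have h1 : p y ≤ ‖x‖⁻¹ * p x := by
      have := hmin hmem
      simpa [map_smul_eq_mul] using this
    rw [inv_mul_eq_div, le_div_iff₀ hxn] at h1
    rw [inv_mul_eq_div, le_div_iff₀ hpy]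
    linarith

theorem abs_dotProduct_le (y x : Fin n → ℝ) : |y ⬝ᵥ x| ≤ (∑ i, |y i|) * ‖x‖ := by
  rw [dotProduct, Finset.sum_mul]
  refine (Finset.abs_sum_le_sum_abs _ _).trans (Finset.sum_le_sum fun i _ => ?_)
  rw [abs_mul]
  exact mul_le_mul_of_nonneg_left (norm_le_pi_norm x i) (abs_nonneg _)

/-- A real `sSup` of an unbounded set is `0`, so the forward direction needs boundedness; it comes
from definiteness of `p` via equivalence with the supremum norm. Taking `x = 0` in the supremum
gives `0 ≤ r`. -/
theorem dualNorm_le_iff {p : Seminorm ℝ (Fin n → ℝ)} (hp : ∀ x, p x = 0 → x = 0)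
    (y : Fin n → ℝ) (r : ℝ) : dualNorm p y ≤ r ↔ 0 ≤ r ∧ ∀ x, y ⬝ᵥ x ≤ r * p x := by
  have hne : {r : ℝ | ∃ x : Fin n → ℝ, p x ≤ 1 ∧ r = y ⬝ᵥ x}.Nonempty := ⟨0, 0, by simp⟩
  constructor
  · intro h
    have hbdd : BddAbove {r : ℝ | ∃ x : Fin n → ℝ, p x ≤ 1 ∧ r = y ⬝ᵥ x} := by
      obtain ⟨C, hC0, hC⟩ := exists_norm_le_mul p hp
      refine ⟨(∑ i, |y i|) * C, ?_⟩
      rintro _ ⟨x, hx, rfl⟩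
      refine (le_abs_self _).trans ((abs_dotProduct_le y x).trans ?_)
      refine mul_le_mul_of_nonneg_left ?_ (Finset.sum_nonneg fun i _ => abs_nonneg _)
      exact (hC x).trans (by nlinarith)
    have hle : ∀ x, p x ≤ 1 → y ⬝ᵥ x ≤ r := fun x hx => (le_csSup hbdd ⟨x, hx, rfl⟩).trans h
    refine ⟨by simpa using hle 0 (by simp), fun x => ?_⟩
    rcases (apply_nonneg p x).eq_or_lt with h0 | hpos
    · rw [hp x h0.symm]; simp
    · have := hle ((p x)⁻¹ • x) (by
        rw [map_smul_eq_mul, norm_inv, Real.norm_of_nonneg hpos.le, inv_mul_cancel₀ hpos.ne'])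
      rwa [dotProduct_smul, smul_eq_mul, inv_mul_eq_div, div_le_iff₀ hpos] at this
  · rintro ⟨hr, h⟩
    refine csSup_le hne ?_
    rintro _ ⟨x, hx, rfl⟩
    exact (h x).trans (by nlinarith)

/-- Every vector has a norming functional of dual norm at most one. -/
theorem exists_norming (p : Seminorm ℝ (Fin n → ℝ)) (x : Fin n → ℝ) :
    ∃ e : Fin n → ℝ, (∀ z, e ⬝ᵥ z ≤ p z) ∧ e ⬝ᵥ x = p x := by
  rcases eq_or_ne x 0 with rfl | hx
  · exact ⟨0, fun z => by simp, by simp⟩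
  -- Hahn–Banach applied to `c • x ↦ c * p x` on the line through `x`, which is dominated by `p`.
  obtain ⟨g, hg, hgp⟩ := exists_extension_of_le_sublinear
    (LinearPMap.mkSpanSingleton x (p x) hx) p
    (fun c hc x => by rw [map_smul_eq_mul, Real.norm_of_nonneg hc.le]) (map_add_le_add p) (by
      rintro ⟨y, hy⟩
      obtain ⟨c, rfl⟩ := Submodule.mem_span_singleton.1 hy
      rw [LinearPMap.mkSpanSingleton'_apply, map_smul_eq_mul, RingHom.id_apply, smul_eq_mul]
      exact mul_le_mul_of_nonneg_right (le_abs_self c) (apply_nonneg p x))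
  have hdot : ∀ z, (fun i => g (Pi.single i 1)) ⬝ᵥ z = g z := fun z => by
    conv_rhs => rw [← (Pi.basisFun ℝ (Fin n)).sum_repr z, map_sum]
    simp [dotProduct, mul_comm]
  refine ⟨fun i => g (Pi.single i 1), fun z => (hdot z).trans_le (hgp z), ?_⟩
  have hx' := hg ⟨x, Submodule.mem_span_singleton_self x⟩
  rw [hdot]
  exact hx'.trans (LinearPMap.mkSpanSingleton_apply ℝ ℝ hx (p x))

/-! ### Strong duality -/

/-- Strict separation of a compact and a closed convex subset of `ℝⁿ × ℝ`, in coordinates. -/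
theorem exists_strict_separation {B K : Set ((Fin n → ℝ) × ℝ)} (hB : Convex ℝ B)
    (hBc : IsCompact B) (hK : Convex ℝ K) (hKc : IsClosed K) (hBK : Disjoint B K) :
    ∃ (x : Fin n → ℝ) (τ c : ℝ), (∀ q ∈ B, x ⬝ᵥ q.1 + τ * q.2 < c) ∧
      ∀ q ∈ K, c < x ⬝ᵥ q.1 + τ * q.2 := by
  obtain ⟨f, c₁, c₂, hf₁, hc, hf₂⟩ := geometric_hahn_banach_compact_closed hB hBc hK hKc hBK
  have hf : ∀ q : (Fin n → ℝ) × ℝ,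
      f q = (fun i => f (Pi.single i 1, 0)) ⬝ᵥ q.1 + f (0, 1) * q.2 := by
    rintro ⟨y, t⟩
    have h1 : f (y, 0) = (fun i => f (Pi.single i 1, 0)) ⬝ᵥ y := by
      have : f (y, 0) = (f.comp (ContinuousLinearMap.inl ℝ (Fin n → ℝ) ℝ)) y := by simp
      rw [this]
      conv_lhs => rw [← (Pi.basisFun ℝ (Fin n)).sum_repr y, map_sum]
      simp [dotProduct, mul_comm]
    have h2 : f (0, t) = f (0, 1) * t := by
      have : ((0 : Fin n → ℝ), t) = t • ((0 : Fin n → ℝ), (1 : ℝ)) := by simp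
      rw [this, map_smul, smul_eq_mul, mul_comm]
    rw [← h1, ← h2, ← map_add]; simp
  exact ⟨_, _, c₂, fun q hq => hf q ▸ (hf₁ q hq).trans hc, fun q hq => hf q ▸ hf₂ q hq⟩

/-- Exact duality for the maximization of `a ⬝ᵥ u - r ‖u‖` over a polyhedron `H u ≤ d` that
contains the origin. -/
theorem exists_multiplier_of_polyhedron {p : Seminorm ℝ (Fin n → ℝ)}
    {H : Matrix (Fin nH) (Fin n) ℝ} {d : Fin nH → ℝ} (hd : 0 ≤ d) {a : Fin n → ℝ} {r β : ℝ}
    (hr : 0 ≤ r) (hβ : ∀ u, H *ᵥ u ≤ d → a ⬝ᵥ u - r * p u ≤ β) :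
    ∃ γ : Fin nH → ℝ, 0 ≤ γ ∧ γ ⬝ᵥ d ≤ β ∧ ∀ x, (Hᵀ *ᵥ γ - a) ⬝ᵥ x ≤ r * p x := by
  have hβ0 : 0 ≤ β := by simpa using hβ 0 (by simpa using hd)
  -- A multiplier exists as soon as the cone generated by the pairs `(H j, d j)` meets `B ×ˢ Set.Icc
  -- 0 β`. The lower bound `0` costs nothing, since `γ ⬝ᵥ d ≥ 0`, and makes the product compact. If
  -- the two sets are disjoint, a separating `(x, τ)` produces a direction `-x` that violates `hβ`.
  set B : Set (Fin n → ℝ) := {y | ∀ x, (y - a) ⬝ᵥ x ≤ r * p x} with hB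
  have hBclosed : IsClosed B := by
    simp only [hB, Set.ofPred_forall]
    refine isClosed_iInter fun x => isClosed_le ?_ continuous_const
    simp only [dotProduct]
    fun_prop
  have hBcompact : IsCompact B := by
    refine (isCompact_Icc (a := fun i => a i - r * p (Pi.single i 1))
      (b := fun i => a i + r * p (Pi.single i 1))).of_isClosed_subset hBclosed fun y hy => ?_
    constructor
    · intro i
      have := hy (-Pi.single i 1)
      simp only [dotProduct_neg, dotProduct_single, mul_one, Pi.sub_apply, map_neg_eq_map] at this
      dsimp only
      linarith
    · intro i
      have := hy (Pi.single i 1)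
      simp only [dotProduct_single, mul_one, Pi.sub_apply] at this
      dsimp only
      linarith
  have hBconvex : Convex ℝ B := by
    intro y hy z hz s t hs ht hst x
    have hs1 : s = 1 - t := by linarith
    have : (s • y + t • z - a) ⬝ᵥ x = s * ((y - a) ⬝ᵥ x) + t * ((z - a) ⬝ᵥ x) := by
      simp only [sub_dotProduct, add_dotProduct, smul_dotProduct, smul_eq_mul, hs1]; ring
    rw [this]
    calc s * ((y - a) ⬝ᵥ x) + t * ((z - a) ⬝ᵥ x) ≤ s * (r * p x) + t * (r * p x) :=
          add_le_add (mul_le_mul_of_nonneg_left (hy x) hs) (mul_le_mul_of_nonneg_left (hz x) ht)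
      _ = r * p x := by rw [← add_mul, hst, one_mul]
  set v : Fin nH → (Fin n → ℝ) × ℝ := fun j => (H j, d j)
  set K : Set ((Fin n → ℝ) × ℝ) :=
    {x | ∃ c : Fin nH → ℝ, (∀ i, 0 ≤ c i) ∧ x = ∑ i, c i • v i} with hK
  have hKclosed : IsClosed K := isClosed_conic_combinations v Finset.univ
  have hKconvex : Convex ℝ K := by
    rintro _ ⟨c, hc, rfl⟩ _ ⟨c', hc', rfl⟩ s t hs ht _
    refine ⟨s • c + t • c', fun i => ?_, ?_⟩
    · exact add_nonneg (mul_nonneg hs (hc i)) (mul_nonneg ht (hc' i))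
    · simp only [Finset.smul_sum, ← Finset.sum_add_distrib, smul_smul, ← add_smul, Pi.add_apply,
        Pi.smul_apply, smul_eq_mul]
  by_cases hdisj : Disjoint (B ×ˢ Set.Icc 0 β) K
  · exfalso
    obtain ⟨x, τ, c₂, hf₁, hf₂⟩ := exists_strict_separation (hBconvex.prod (convex_Icc 0 β))
      (hBcompact.prod isCompact_Icc) hKconvex hKclosed hdisj
    have hc₂ : c₂ < 0 := by
      have := hf₂ 0 ⟨0, fun _ => le_rfl, by simp⟩
      simpa using this
    have hneg : ∀ y ∈ B, ∀ t ∈ Set.Icc 0 β, x ⬝ᵥ y + τ * t < 0 := fun y hy t ht => by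
      exact (hf₁ (y, t) ⟨hy, ht⟩).trans hc₂
    -- A linear functional bounded below on a cone is nonnegative on its generators, as a negative
    -- value could be scaled down to `c₂`.
    have hpos : ∀ j, 0 ≤ x ⬝ᵥ H j + τ * d j := fun j => by
      by_contra hlt
      push Not at hlt
      have hk : ∀ k : ℝ, 0 ≤ k → c₂ < k * (x ⬝ᵥ H j + τ * d j) := fun k hk => by
        have := hf₂ (k • v j) ⟨Pi.single j k, fun i => by
          rcases eq_or_ne i j with rfl | h
          · simpa using hk
          · simp [h], by
          rw [Finset.sum_eq_single j (fun i _ h => by simp [h]) (by simp)]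
          simp⟩
        simp only [v, Prod.smul_mk, dotProduct_smul, smul_eq_mul] at this
        linarith
      have := hk (c₂ / (x ⬝ᵥ H j + τ * d j)) (div_nonneg_of_nonpos hc₂.le hlt.le)
      rw [div_mul_cancel₀ _ hlt.ne] at this
      exact lt_irrefl _ this
    -- The point `a - r • e` maximizes `y ↦ (-x) ⬝ᵥ y` reversed in sign: it is the element of `B`
    -- with the smallest pairing with `-x`, so its value recovers the primal objective at `-x`.
    obtain ⟨e, he, hex⟩ := exists_norming p (-x)
    have hyB : a - r • e ∈ B := fun z => by
      have := he (-z)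
      rw [dotProduct_neg, map_neg_eq_map] at this
      rw [sub_sub_cancel_left, neg_dotProduct, smul_dotProduct, smul_eq_mul]
      nlinarith [mul_le_mul_of_nonneg_left this hr]
    have hxy : x ⬝ᵥ (a - r • e) = -(a ⬝ᵥ (-x) - r * p (-x)) := by
      rw [← hex, dotProduct_sub, dotProduct_smul, smul_eq_mul, dotProduct_neg, dotProduct_neg,
        dotProduct_comm x a, dotProduct_comm x e]
      ring
    have hHx : ∀ j, (H *ᵥ (-x)) j ≤ τ * d j := fun j => by
      have := hpos j
      rw [dotProduct_comm] at this
      simp only [mulVec, dotProduct_neg]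
      linarith
    -- For `τ ≤ 0`, `-x` is a recession direction of the polyhedron with positive objective `δ`, and
    -- the scaling below reaches the value `β + 1`. For `τ > 0`, the rescaled point `τ⁻¹ • (-x)` is
    -- feasible with value above `β`.
    rcases le_or_gt τ 0 with hτ | hτ
    · have h0 := hneg _ hyB 0 ⟨le_rfl, hβ0⟩
      rw [hxy] at h0
      set δ := a ⬝ᵥ (-x) - r * p (-x)
      have hδ : 0 < δ := by linarith
      have hkey := hβ (((β + 1) / δ) • (-x)) (fun j => by
        rw [mulVec_smul, Pi.smul_apply, smul_eq_mul]
        have h1 : (H *ᵥ (-x)) j ≤ 0 :=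
          (hHx j).trans (mul_nonpos_of_nonpos_of_nonneg hτ (hd j))
        exact (mul_nonpos_of_nonneg_of_nonpos (by positivity) h1).trans (hd j))
      rw [dotProduct_smul, map_smul_eq_mul, Real.norm_of_nonneg (by positivity), smul_eq_mul] at hkey
      have : (β + 1) / δ * δ = β + 1 := div_mul_cancel₀ _ hδ.ne'
      have h3 : (β + 1) / δ * δ
          = (β + 1) / δ * (a ⬝ᵥ (-x)) - r * ((β + 1) / δ * p (-x)) := by
        simp only [δ]; ring
      linarith
    · have h0 := hneg _ hyB β ⟨hβ0, le_rfl⟩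
      rw [hxy] at h0
      have hkey := hβ (τ⁻¹ • (-x)) (fun j => by
        rw [mulVec_smul, Pi.smul_apply, smul_eq_mul, inv_mul_le_iff₀ hτ]
        exact hHx j)
      rw [dotProduct_smul, map_smul_eq_mul, Real.norm_of_nonneg (by positivity), smul_eq_mul] at hkey
      have h3 : τ⁻¹ * (a ⬝ᵥ (-x) - r * p (-x)) ≤ β := by
        refine le_trans (le_of_eq ?_) hkey
        ring
      rw [inv_mul_le_iff₀ hτ] at h3
      linarith
  · rw [Set.not_disjoint_iff] at hdisj
    obtain ⟨⟨y, t⟩, ⟨hy, ht⟩, γ, hγ, heq⟩ := hdisj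
    have h1 : y = Hᵀ *ᵥ γ := by
      have := congrArg Prod.fst heq
      simp only [Prod.fst_sum, Prod.smul_fst, v] at this
      rw [this]
      ext i
      simp [mulVec, dotProduct, Finset.sum_apply, mul_comm]
    have h2 : t = γ ⬝ᵥ d := by
      have := congrArg Prod.snd heq
      simpa only [Prod.snd_sum, Prod.smul_snd, v, smul_eq_mul, dotProduct] using this
    refine ⟨γ, hγ, h2 ▸ ht.2, fun x => ?_⟩
    rw [← h1]
    exact hy x

/-- Lagrange multiplier for one convex constraint satisfying Slater's condition. -/
theorem exists_lagrange_multiplier {E : Type*} [AddCommGroup E] [Module ℝ E] {C : Set E}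
    {φ ψ : E → ℝ} (hφ : ConvexOn ℝ C φ) (hψ : ConcaveOn ℝ C ψ) {x₀ : E} (hx₀ : x₀ ∈ C)
    (hslater : φ x₀ < 0) {V : ℝ} (hV : ∀ x ∈ C, φ x ≤ 0 → ψ x ≤ V) :
    ∃ r : ℝ, 0 ≤ r ∧ ∀ x ∈ C, ψ x - r * φ x ≤ V := by
  -- The weights are those for which the chord of `φ` from `y` to `x` vanishes, so the combination
  -- is feasible. Every slope from an infeasible point is thus at most every slope from a strictly
  -- feasible one, and `r` can be put in between.
  have hcross : ∀ x ∈ C, 0 < φ x → ∀ y ∈ C, φ y < 0 →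
      (ψ x - V) / φ x ≤ (V - ψ y) / (-φ y) := by
    intro x hx hφx y hy hφy
    have hD : 0 < φ x - φ y := by linarith
    have ha : 0 ≤ -φ y / (φ x - φ y) := div_nonneg (by linarith) hD.le
    have hb : 0 ≤ φ x / (φ x - φ y) := div_nonneg hφx.le hD.le
    have hab : -φ y / (φ x - φ y) + φ x / (φ x - φ y) = 1 := by field_simp; ring
    have h1 := hφ.2 hx hy ha hb hab
    have h2 := hψ.2 hx hy ha hb hab
    simp only [smul_eq_mul] at h1 h2
    have h3 := hV _ (hφ.1 hx hy ha hb hab) (h1.trans (le_of_eq (by field_simp; ring)))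
    have h4 := h2.trans h3
    rw [div_mul_eq_mul_div, div_mul_eq_mul_div, ← add_div, div_le_iff₀ hD] at h4
    rw [div_le_div_iff₀ hφx (by linarith)]
    nlinarith
  -- Inserting `0` makes `S` nonempty and forces `0 ≤ sSup S`.
  set S : Set ℝ := insert 0 {q | ∃ x ∈ C, 0 < φ x ∧ q = (ψ x - V) / φ x} with hS
  have hub : ∀ y ∈ C, φ y < 0 → ∀ q ∈ S, q ≤ (V - ψ y) / (-φ y) := by
    rintro y hy hφy q (rfl | ⟨x, hx, hφx, rfl⟩)
    · exact div_nonneg (by linarith [hV y hy hφy.le]) (by linarith)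
    · exact hcross x hx hφx y hy hφy
  have hbdd : BddAbove S := ⟨_, hub x₀ hx₀ hslater⟩
  refine ⟨sSup S, le_csSup hbdd (Set.mem_insert _ _), fun x hx => ?_⟩
  rcases lt_trichotomy (φ x) 0 with h | h | h
  · have := csSup_le ⟨0, Set.mem_insert _ _⟩ (hub x hx h)
    rw [le_div_iff₀ (by linarith)] at this
    linarith
  · rw [h, mul_zero, sub_zero]
    exact hV x hx h.le
  · have := le_csSup hbdd (Set.mem_insert_of_mem _ ⟨x, hx, h, rfl⟩ : (ψ x - V) / φ x ∈ S)
    rw [div_le_iff₀ h] at this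
    linarith

/-- If a separable sum is bounded on a product set, the bound splits over the factors. -/
theorem exists_bounds_of_sum_le {ι α : Type*} [Fintype ι] {S : ι → Set α}
    {g : ι → α → ℝ} (hne : ∀ i, (S i).Nonempty) {b : ℝ}
    (h : ∀ x : ι → α, (∀ i, x i ∈ S i) → ∑ i, g i (x i) ≤ b) :
    ∃ V : ι → ℝ, (∀ i, ∀ x ∈ S i, g i x ≤ V i) ∧ ∑ i, V i ≤ b := by
  classical
  choose x₀ hx₀ using hne
  have hbdd : ∀ i, BddAbove (g i '' S i) := fun i => by
    refine ⟨b - ∑ j ∈ Finset.univ.erase i, g j (x₀ j), ?_⟩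
    rintro _ ⟨x, hx, rfl⟩
    have := h (Function.update x₀ i x) (fun j => by
      rcases eq_or_ne j i with rfl | hj
      · simpa using hx
      · simpa [hj] using hx₀ j)
    rw [← Finset.add_sum_erase _ _ (Finset.mem_univ i), Function.update_self,
      Finset.sum_congr rfl fun j hj => by
        rw [Function.update_of_ne (Finset.ne_of_mem_erase hj)]] at this
    linarith
  refine ⟨fun i => sSup (g i '' S i), fun i x hx => le_csSup (hbdd i) ⟨x, hx, rfl⟩, ?_⟩
  refine le_of_forall_pos_le_add fun δ hδ => ?_
  -- The `+ 1` covers an empty index type.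
  have hδ' : 0 < δ / (Fintype.card ι + 1) := by positivity
  have hex : ∀ i, ∃ x ∈ S i, sSup (g i '' S i) - δ / (Fintype.card ι + 1) < g i x := fun i => by
    obtain ⟨_, ⟨x, hx, rfl⟩, hlt⟩ := exists_lt_of_lt_csSup (s := g i '' S i) ⟨_, x₀ i, hx₀ i, rfl⟩
      (sub_lt_self _ hδ')
    exact ⟨x, hx, hlt⟩
  choose x hx hlt using hex
  calc ∑ i, sSup (g i '' S i) ≤ ∑ i, (g i (x i) + δ / (Fintype.card ι + 1)) :=
        Finset.sum_le_sum fun i _ => by linarith [hlt i]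
    _ = ∑ i, g i (x i) + Fintype.card ι * (δ / (Fintype.card ι + 1)) := by
        simp [Finset.sum_add_distrib]
    _ ≤ b + δ := by
        refine add_le_add (h x hx) ?_
        rw [← mul_div_assoc, div_le_iff₀ (by positivity)]
        nlinarith

theorem convex_polyhedron (H : Matrix (Fin nH) (Fin n) ℝ) (h : Fin nH → ℝ) :
    Convex ℝ (polyhedron H h) := by
  intro x hx y hy s t hs ht hst i
  have h1 := mul_le_mul_of_nonneg_left (hx i) hs
  have h2 := mul_le_mul_of_nonneg_left (hy i) ht
  rw [mulVec_add, mulVec_smul, mulVec_smul]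
  simp only [Pi.add_apply, Pi.smul_apply, smul_eq_mul]
  calc _ ≤ s * h i + t * h i := add_le_add h1 h2
    _ = h i := by rw [← add_mul, hst, one_mul]

/-- Strong duality, with attained dual optimum, for the transport problem in which the mass of each
sample is moved to one point of the polyhedron. -/
theorem exists_dual_of_transport_le {p : Seminorm ℝ (Fin n → ℝ)}
    {H : Matrix (Fin nH) (Fin n) ℝ} {h : Fin nH → ℝ} {ŵ : Fin M → Fin n → ℝ} (hM : 0 < M)
    (hŵ : ∀ l, ŵ l ∈ polyhedron H h) {ε : ℝ} (hε : 0 < ε) {a : Fin n → ℝ} {V : ℝ}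
    (hV : ∀ w : Fin M → Fin n → ℝ, (∀ l, w l ∈ polyhedron H h) →
      (1 / (M : ℝ)) * ∑ l, p (ŵ l - w l) ≤ ε → (1 / (M : ℝ)) * ∑ l, a ⬝ᵥ w l ≤ V) :
    ∃ (r : ℝ) (s : Fin M → ℝ) (γ : Fin M → Fin nH → ℝ), 0 ≤ r ∧
      r * ε + (1 / (M : ℝ)) * ∑ l, s l ≤ V ∧
      ∀ l, a ⬝ᵥ ŵ l + γ l ⬝ᵥ (h - H *ᵥ ŵ l) ≤ s l ∧
        (∀ x, (Hᵀ *ᵥ γ l - a) ⬝ᵥ x ≤ r * p x) ∧ 0 ≤ γ l := by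
  have hM' : (0 : ℝ) < M := Nat.cast_pos.2 hM
  set C : Set (Fin M → Fin n → ℝ) := {w | ∀ l, w l ∈ polyhedron H h}
  have hC : Convex ℝ C := fun x hx y hy s t hs ht hst l =>
    convex_polyhedron H h (hx l) (hy l) hs ht hst
  have hφ : ConvexOn ℝ C fun w => (1 / (M : ℝ)) * ∑ l, p (ŵ l - w l) - ε := by
    refine ⟨hC, fun x _ y _ s t hs ht hst => ?_⟩
    have hl : ∀ l, p (ŵ l - (s • x + t • y) l) ≤ s * p (ŵ l - x l) + t * p (ŵ l - y l) := fun l => by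
      have : ŵ l - (s • x + t • y) l = s • (ŵ l - x l) + t • (ŵ l - y l) := by
        have hs1 : s = 1 - t := by linarith
        ext i
        simp only [Pi.sub_apply, Pi.add_apply, Pi.smul_apply, smul_eq_mul, hs1]; ring
      rw [this]
      refine (map_add_le_add p _ _).trans (le_of_eq ?_)
      rw [map_smul_eq_mul, map_smul_eq_mul, Real.norm_of_nonneg hs, Real.norm_of_nonneg ht]
    have hsum := Finset.sum_le_sum fun l (_ : l ∈ Finset.univ) => hl l
    rw [Finset.sum_add_distrib, ← Finset.mul_sum, ← Finset.mul_sum] at hsum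
    have h2 := mul_le_mul_of_nonneg_left hsum (one_div_nonneg.2 hM'.le)
    have hs1 : s = 1 - t := by linarith
    simp only [smul_eq_mul]
    refine (sub_le_sub_right h2 ε).trans (le_of_eq ?_)
    rw [hs1]; ring
  have hψ : ConcaveOn ℝ C fun w => (1 / (M : ℝ)) * ∑ l, a ⬝ᵥ w l := by
    refine ⟨hC, fun x _ y _ s t _ _ _ => le_of_eq ?_⟩
    simp only [smul_eq_mul, Pi.add_apply, Pi.smul_apply, dotProduct_add, dotProduct_smul,
      Finset.sum_add_distrib, ← Finset.mul_sum]
    ring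
  obtain ⟨r, hr, hrV⟩ := exists_lagrange_multiplier hφ hψ (x₀ := ŵ) hŵ (by simpa using hε)
    (V := V) (fun w hw hφw => hV w hw (by linarith))
  -- With `r` fixed, the points `w l` are coupled by no constraint, so the bound on the Lagrangian
  -- splits over samples.
  obtain ⟨s, hs, hsum⟩ := exists_bounds_of_sum_le (ι := Fin M) (S := fun _ => polyhedron H h)
    (g := fun l w => a ⬝ᵥ w - r * p (ŵ l - w)) (b := M * (V - r * ε)) (fun l => ⟨ŵ l, hŵ l⟩)
    (fun w hw => by
      have := hrV w hw
      rw [Finset.sum_sub_distrib, ← Finset.mul_sum]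
      have h3 : (1 / (M : ℝ)) * (∑ l, a ⬝ᵥ w l - r * ∑ l, p (ŵ l - w l)) ≤ V - r * ε := by
        linarith
      rw [one_div, inv_mul_le_iff₀ hM'] at h3
      exact h3)
  have hγ : ∀ l, ∃ γ : Fin nH → ℝ, 0 ≤ γ ∧ γ ⬝ᵥ (h - H *ᵥ ŵ l) ≤ s l - a ⬝ᵥ ŵ l ∧
      ∀ x, (Hᵀ *ᵥ γ - a) ⬝ᵥ x ≤ r * p x := fun l => by
    -- Recentring at the sample by `w = ŵ l + u` puts the origin in the polyhedron.
    refine exists_multiplier_of_polyhedron (sub_nonneg.2 (hŵ l)) hr fun u hu => ?_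
    have hmem : ŵ l + u ∈ polyhedron H h := by
      simp only [polyhedron, Set.mem_ofPred_eq, mulVec_add]
      exact add_le_of_le_sub_left hu
    have := hs l _ hmem
    rw [dotProduct_add, sub_add_cancel_left, map_neg_eq_map] at this
    linarith
  choose γ hγ0 hγd hγx using hγ
  refine ⟨r, s, γ, hr, ?_, fun l => ⟨by linarith [hγd l], hγx l, hγ0 l⟩⟩
  have : (1 / (M : ℝ)) * ∑ l, s l ≤ V - r * ε := by
    rw [one_div, inv_mul_le_iff₀ hM']
    exact hsum
  linarith

/-! ### Empirical distributions and Wasserstein balls -/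

instance isProbabilityMeasure_empirical [NeZero M] (w : Fin M → Fin n → ℝ) :
    IsProbabilityMeasure (empirical w) := ⟨by
  simp only [empirical, Measure.smul_apply, Measure.finsetSum_apply, measure_univ, smul_eq_mul]
  simpa using ENNReal.inv_mul_cancel (Nat.cast_ne_zero.2 (NeZero.ne M)) (ENNReal.natCast_ne_top M)⟩

theorem lintegral_empirical (w : Fin M → Fin n → ℝ) (g : (Fin n → ℝ) → ℝ≥0∞) :
    ∫⁻ x, g x ∂empirical w = (M : ℝ≥0∞)⁻¹ * ∑ l, g (w l) := by
  simp [empirical, lintegral_finsetSum_measure]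

theorem integrable_empirical (hM : 0 < M) (w : Fin M → Fin n → ℝ) (g : (Fin n → ℝ) → ℝ) :
    Integrable g (empirical w) := by
  refine Integrable.smul_measure ?_ (ENNReal.inv_ne_top.2 (Nat.cast_ne_zero.2 hM.ne'))
  exact integrable_finsetSum_measure.2 fun l _ => integrable_dirac (by simp)

theorem integral_empirical (w : Fin M → Fin n → ℝ) (g : (Fin n → ℝ) → ℝ) :
    ∫ x, g x ∂empirical w = (1 / (M : ℝ)) * ∑ l, g (w l) := by
  rw [empirical, integral_smul_measure,
    integral_finsetSum_measure fun l _ => integrable_dirac (by simp)]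
  simp

theorem ae_empirical {w : Fin M → Fin n → ℝ} {q : (Fin n → ℝ) → Prop} (h : ∀ l, q (w l)) :
    ∀ᵐ x ∂empirical w, q x := by
  have : empirical w {x | ¬ q x} = 0 := by
    simp [empirical, Measure.finsetSum_apply, h]
  exact this

/-- Moving each sample to a point of the support yields a distribution of the Wasserstein ball,
provided the average displacement is at most the radius. -/
theorem empirical_mem_wassersteinBall [NeZero M] {p : Seminorm ℝ (Fin n → ℝ)}
    {W : Set (Fin n → ℝ)} {ŵ w : Fin M → Fin n → ℝ} (hw : ∀ l, w l ∈ W) {ε : ℝ}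
    (hdist : (1 / (M : ℝ)) * ∑ l, p (ŵ l - w l) ≤ ε) :
    (⟨empirical w, inferInstance⟩ : ProbabilityMeasure (Fin n → ℝ)) ∈
      wassersteinBall p W (empirical ŵ) ε := by
  have hMpos : (0 : ℝ) < M := Nat.cast_pos.2 (NeZero.pos M)
  refine ⟨ae_empirical (q := fun x => x ∈ W) hw, ?_, ?_⟩
  · change ∫⁻ ξ, ENNReal.ofReal (p ξ) ∂empirical w < ∞
    rw [lintegral_empirical]
    exact ENNReal.mul_lt_top (ENNReal.inv_lt_top.2 (Nat.cast_pos.2 (NeZero.pos M)))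
      (ENNReal.sum_lt_top.2 fun l _ => ENNReal.ofReal_lt_top)
  · change wasserstein p (empirical ŵ) (empirical w) ≤ _
    -- The coupling transports `ŵ l` entirely to `w l`.
    refine iInf₂_le_of_le
      ((M : ℝ≥0∞)⁻¹ • ∑ l : Fin M, Measure.dirac (ŵ l, w l)) ⟨?_, ?_⟩ ?_
    · rw [Measure.map_smul, Measure.map_finset_sum (measurable_fst.aemeasurable)]
      simp [empirical, Measure.map_dirac]
    · rw [Measure.map_smul, Measure.map_finset_sum (measurable_snd.aemeasurable)]
      simp [empirical, Measure.map_dirac]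
    · rw [lintegral_smul_measure, lintegral_finsetSum_measure]
      simp only [lintegral_dirac, smul_eq_mul]
      rw [← ENNReal.ofReal_sum_of_nonneg fun l _ => apply_nonneg p _, ← ENNReal.ofReal_natCast,
        ← ENNReal.ofReal_inv_of_pos hMpos, ← ENNReal.ofReal_mul (inv_nonneg.2 hMpos.le)]
      exact ENNReal.ofReal_le_ofReal (by simpa using hdist)

theorem integrable_dotProduct {p : Seminorm ℝ (Fin n → ℝ)} (hp : ∀ x, p x = 0 → x = 0)
    {μ : Measure (Fin n → ℝ)} (hμ : ∫⁻ ξ, ENNReal.ofReal (p ξ) ∂μ < ∞) (a : Fin n → ℝ) :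
    Integrable (fun w => a ⬝ᵥ w) μ := by
  have hpint : Integrable p μ :=
    ⟨(seminorm_continuous p).aestronglyMeasurable,
      (hasFiniteIntegral_iff_ofReal (.of_forall fun x => apply_nonneg p x)).2 hμ⟩
  obtain ⟨C, hC0, hC⟩ := exists_norm_le_mul p hp
  refine (hpint.const_mul ((∑ i, |a i|) * C)).mono' ?_ (.of_forall fun x => ?_)
  · refine Continuous.aestronglyMeasurable ?_
    simp only [dotProduct]
    fun_prop
  · rw [Real.norm_eq_abs, mul_assoc]
    exact (abs_dotProduct_le a x).trans (mul_le_mul_of_nonneg_left (hC x)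
      (Finset.sum_nonneg fun i _ => abs_nonneg _))

/-- Expand `a ⬝ᵥ w = a ⬝ᵥ x + (Hᵀ *ᵥ γ - a) ⬝ᵥ (x - w) - γ ⬝ᵥ (H *ᵥ (x - w))` and use `γ ⬝ᵥ (H *ᵥ w)
≤ γ ⬝ᵥ h`. -/
theorem dotProduct_le_of_dual {p : Seminorm ℝ (Fin n → ℝ)} {H : Matrix (Fin nH) (Fin n) ℝ}
    {h : Fin nH → ℝ} {a x w : Fin n → ℝ} {γ : Fin nH → ℝ} {r s : ℝ} (hw : w ∈ polyhedron H h)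
    (hγ : 0 ≤ γ) (hs : a ⬝ᵥ x + γ ⬝ᵥ (h - H *ᵥ x) ≤ s)
    (hr : ∀ u, (Hᵀ *ᵥ γ - a) ⬝ᵥ u ≤ r * p u) :
    a ⬝ᵥ w ≤ s + r * p (x - w) := by
  have h1 := hr (x - w)
  have h2 : γ ⬝ᵥ (H *ᵥ w) ≤ γ ⬝ᵥ h := dotProduct_le_dotProduct_of_nonneg_left hw hγ
  rw [mulVec_transpose, sub_dotProduct, dotProduct_sub, dotProduct_sub, ← dotProduct_mulVec,
    ← dotProduct_mulVec] at h1
  rw [dotProduct_sub] at hs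
  linarith

theorem integral_le_of_coupling (hM : 0 < M) {p : Seminorm ℝ (Fin n → ℝ)}
    {W : Set (Fin n → ℝ)} (hWne : W.Nonempty) {ŵ : Fin M → Fin n → ℝ}
    {μ : Measure (Fin n → ℝ)} (hμW : μ Wᶜ = 0) {a : Fin n → ℝ}
    (hint : Integrable (fun w => a ⬝ᵥ w) μ) {r : ℝ} {s : Fin M → ℝ}
    (hs : ∀ l, ∀ w ∈ W, a ⬝ᵥ w ≤ s l + r * p (ŵ l - w))
    {π : Measure ((Fin n → ℝ) × (Fin n → ℝ))} (hπ : IsCoupling π (empirical ŵ) μ)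
    (hfin : ∫⁻ ξ, ENNReal.ofReal (p (ξ.1 - ξ.2)) ∂π ≠ ∞) :
    ∫ w, a ⬝ᵥ w ∂μ ≤ r * (∫⁻ ξ, ENNReal.ofReal (p (ξ.1 - ξ.2)) ∂π).toReal
      + (1 / (M : ℝ)) * ∑ l, s l := by
  obtain ⟨h₁, h₂⟩ := hπ
  -- Samples may coincide while their `s l` differ, so `s` need not be a function of the point. `σ`
  -- is one, and it is the least admissible bound at each sample. No regularity of `σ` is required,
  -- because the first marginal is finitely supported.
  set σ : (Fin n → ℝ) → ℝ := fun x => sSup ((fun w => a ⬝ᵥ w - r * p (x - w)) '' W)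
  have hσs : ∀ l, σ (ŵ l) ≤ s l := fun l => by
    refine csSup_le (hWne.image _) ?_
    rintro _ ⟨w, hw, rfl⟩
    linarith [hs l w hw]
  have hσ : ∀ l, ∀ w ∈ W, a ⬝ᵥ w ≤ σ (ŵ l) + r * p (ŵ l - w) := fun l w hw => by
    have : a ⬝ᵥ w - r * p (ŵ l - w) ≤ σ (ŵ l) := by
      refine le_csSup ⟨s l, ?_⟩ ⟨w, hw, rfl⟩
      rintro _ ⟨w', hw', rfl⟩
      linarith [hs l w' hw']
    linarith
  have hae₁ : ∀ᵐ ξ ∂π, ∃ l, ŵ l = ξ.1 := by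
    refine ae_of_ae_map measurable_fst.aemeasurable (p := fun x => ∃ l, ŵ l = x) ?_
    rw [h₁]
    exact ae_empirical fun l => ⟨l, rfl⟩
  have hae₂ : ∀ᵐ ξ ∂π, ξ.2 ∈ W := by
    refine ae_of_ae_map measurable_snd.aemeasurable (p := fun x => x ∈ W) ?_
    rw [h₂]
    exact hμW
  have hpc : Continuous fun ξ : (Fin n → ℝ) × (Fin n → ℝ) => p (ξ.1 - ξ.2) :=
    (seminorm_continuous p).comp (continuous_fst.sub continuous_snd)
  have hpint : Integrable (fun ξ : (Fin n → ℝ) × (Fin n → ℝ) => p (ξ.1 - ξ.2)) π :=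
    ⟨hpc.aestronglyMeasurable,
      (hasFiniteIntegral_iff_ofReal (.of_forall fun x => apply_nonneg p _)).2 hfin.lt_top⟩
  have hpval : ∫ ξ, p (ξ.1 - ξ.2) ∂π = (∫⁻ ξ, ENNReal.ofReal (p (ξ.1 - ξ.2)) ∂π).toReal :=
    integral_eq_lintegral_of_nonneg_ae (.of_forall fun x => apply_nonneg p _)
      hpc.aestronglyMeasurable
  have hσint : Integrable σ (π.map Prod.fst) := h₁ ▸ integrable_empirical hM ŵ σ
  have hσval : ∫ ξ, σ ξ.1 ∂π = (1 / (M : ℝ)) * ∑ l, σ (ŵ l) := by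
    rw [← integral_empirical, ← h₁,
      integral_map measurable_fst.aemeasurable hσint.aestronglyMeasurable]
  have haint : Integrable (fun w => a ⬝ᵥ w) (π.map Prod.snd) := h₂.symm ▸ hint
  have haval : ∫ w, a ⬝ᵥ w ∂μ = ∫ ξ, a ⬝ᵥ ξ.2 ∂π := by
    rw [← h₂, integral_map measurable_snd.aemeasurable haint.aestronglyMeasurable]
  have hσint' : Integrable (fun ξ : (Fin n → ℝ) × (Fin n → ℝ) => σ ξ.1) π :=
    hσint.comp_measurable measurable_fst
  calc ∫ w, a ⬝ᵥ w ∂μ = ∫ ξ, a ⬝ᵥ ξ.2 ∂π := haval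
    _ ≤ ∫ ξ, (σ ξ.1 + r * p (ξ.1 - ξ.2)) ∂π := by
        refine integral_mono_ae (haint.comp_measurable measurable_snd)
          (hσint'.add (hpint.const_mul r)) ?_
        filter_upwards [hae₁, hae₂] with ξ ⟨l, hl⟩ hξ
        rw [← hl]
        exact hσ l _ hξ
    _ = (1 / (M : ℝ)) * ∑ l, σ (ŵ l) + r * ∫ ξ, p (ξ.1 - ξ.2) ∂π := by
        rw [integral_add hσint' (hpint.const_mul r), integral_const_mul, hσval]
    _ ≤ _ := by
        rw [hpval, add_comm]
        gcongr with l
        exact hσs l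

/-- Weak duality over the Wasserstein ball. -/
theorem integral_le_of_mem_wassersteinBall (hM : 0 < M) {p : Seminorm ℝ (Fin n → ℝ)}
    (hp : ∀ x, p x = 0 → x = 0) {W : Set (Fin n → ℝ)} (hWne : W.Nonempty)
    {ŵ : Fin M → Fin n → ℝ} {ε : ℝ} (hε : 0 < ε) {μ : ProbabilityMeasure (Fin n → ℝ)}
    (hμ : μ ∈ wassersteinBall p W (empirical ŵ) ε) {a : Fin n → ℝ} {r : ℝ} (hr : 0 ≤ r)
    {s : Fin M → ℝ} (hs : ∀ l, ∀ w ∈ W, a ⬝ᵥ w ≤ s l + r * p (ŵ l - w)) :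
    ∫ w, a ⬝ᵥ w ∂(μ : Measure (Fin n → ℝ)) ≤ r * ε + (1 / (M : ℝ)) * ∑ l, s l := by
  obtain ⟨hμW, hμfin, hμε⟩ := hμ
  refine le_of_forall_pos_le_add fun δ hδ => ?_
  -- An optimal coupling is not assumed to exist, so the radius is relaxed slightly; `r + 1` also
  -- handles `r = 0`.
  have hδ' : 0 < δ / (r + 1) := by positivity
  have hlt : wasserstein p (empirical ŵ) (μ : Measure (Fin n → ℝ))
      < ENNReal.ofReal (ε + δ / (r + 1)) :=
    hμε.trans_lt ((ENNReal.ofReal_lt_ofReal_iff (by positivity)).2 (by linarith))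
  simp only [wasserstein, iInf_lt_iff] at hlt
  obtain ⟨π, hπ, hπlt⟩ := hlt
  have hle := integral_le_of_coupling hM hWne hμW (integrable_dotProduct hp hμfin a) hs hπ
    hπlt.ne_top
  have hreal := ENNReal.toReal_le_of_le_ofReal (by positivity) hπlt.le
  have h1 := mul_le_mul_of_nonneg_left hreal hr
  have h2 : r * (δ / (r + 1)) ≤ δ := by
    rw [← mul_div_assoc, div_le_iff₀ (by positivity)]
    nlinarith
  linarith [mul_add r ε (δ / (r + 1))]

/-- The expectation of an affine function of independent disturbances. -/
theorem integral_pi_affine {k : ℕ} (μ : Fin k → ProbabilityMeasure (Fin n → ℝ))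
    (b z : Fin n → ℝ) (Φ : Fin k → Matrix (Fin n) (Fin n) ℝ)
    (hint : ∀ m, Integrable (fun w => (b ᵥ* Φ m) ⬝ᵥ w) (μ m : Measure (Fin n → ℝ))) :
    ∫ W : Fin k → Fin n → ℝ, b ⬝ᵥ (z + ∑ m, Φ m *ᵥ W m)
        ∂(Measure.pi fun m => (μ m : Measure (Fin n → ℝ)))
      = b ⬝ᵥ z + ∑ m, ∫ w, (b ᵥ* Φ m) ⬝ᵥ w ∂(μ m : Measure (Fin n → ℝ)) := by
  have hmp := fun m => measurePreserving_eval (fun m => (μ m : Measure (Fin n → ℝ))) m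
  have hI : ∀ m, Integrable (fun W : Fin k → Fin n → ℝ => (b ᵥ* Φ m) ⬝ᵥ W m)
      (Measure.pi fun m => (μ m : Measure (Fin n → ℝ))) := fun m =>
    (hmp m).integrable_comp_of_integrable (hint m)
  simp only [dotProduct_add, dotProduct_sum, dotProduct_mulVec]
  rw [integral_add (integrable_const _) (integrable_finsetSum _ fun m _ => hI m),
    integral_finsetSum _ fun m _ => hI m, integral_const, probReal_univ, one_smul]
  congr 1
  refine Finset.sum_congr rfl fun m _ => ?_
  have h1 := integral_map (μ := Measure.pi fun m => (μ m : Measure (Fin n → ℝ)))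
    (hmp m).measurable.aemeasurable (f := fun w => (b ᵥ* Φ m) ⬝ᵥ w)
    ((hmp m).map_eq.symm ▸ (hint m).aestronglyMeasurable)
  rw [(hmp m).map_eq] at h1
  exact h1.symm

/-! ### The reformulation -/

variable {nx nu nF N : ℕ} (D : Data nx nu nF nH N M)

namespace Data

/-- The worst-case expectation is bounded by `b` iff the dual system is solvable. -/
theorem worstCase_le_iff (hM : 0 < M) (hnrm : ∀ x, D.nrm x = 0 → x = 0) (hε : 0 < D.ε)
    (hsample : ∀ m l, D.sample m l ∈ polyhedron D.H D.h) (P : Plan nx nu N) (i : Fin N)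
    (k : Fin nF) (b : ℝ) :
    D.worstCase P i k ≤ (b : EReal) ↔
      ∃ (lam : Fin (i.val + 1) → ℝ) (s : Fin (i.val + 1) → Fin M → ℝ)
        (γ : Fin (i.val + 1) → Fin M → Fin nH → ℝ),
        (∑ m, (lam m * D.ε + (1 / (M : ℝ)) * ∑ l, s m l) ≤ b - D.F k ⬝ᵥ P.z i.succ) ∧
        ∀ (m : Fin (i.val + 1)) (l : Fin M),
          (D.F k ᵥ* D.transition P i m) ⬝ᵥ D.sampleAt i m l
              + γ m l ⬝ᵥ (D.h - D.H *ᵥ D.sampleAt i m l) ≤ s m l ∧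
          dualNorm D.nrm (D.Hᵀ *ᵥ γ m l - D.F k ᵥ* D.transition P i m) ≤ lam m ∧
          0 ≤ γ m l := by
  have : NeZero M := ⟨hM.ne'⟩
  have hmem : ∀ m l, D.sampleAt i m l ∈ polyhedron D.H D.h := fun m l => hsample _ l
  -- The finite first moment in the ambiguity set provides integrability, without which the Bochner
  -- integral would default to `0`.
  have hval : ∀ ℙ : Fin (i.val + 1) → ProbabilityMeasure (Fin nx → ℝ),
      (∀ m, ℙ m ∈ D.ambiguity i m) → _ := fun ℙ hℙ =>
    integral_pi_affine ℙ (D.F k) (P.z i.succ) (D.transition P i) fun m =>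
      integrable_dotProduct hnrm (hℙ m).2.1 _
  simp only [worstCase, iSup_le_iff, EReal.coe_le_coe_iff]
  constructor
  · intro hle
    -- The constraint is tested only on products of displaced empirical distributions; since these
    -- vary independently over the steps, the total budget splits into bounds `V m`.
    obtain ⟨V, hV, hsum⟩ := exists_bounds_of_sum_le (ι := Fin (i.val + 1))
      (S := fun m => {w : Fin M → Fin nx → ℝ | (∀ l, w l ∈ polyhedron D.H D.h) ∧
        (1 / (M : ℝ)) * ∑ l, D.nrm (D.sampleAt i m l - w l) ≤ D.ε})
      (g := fun m w => (1 / (M : ℝ)) * ∑ l, (D.F k ᵥ* D.transition P i m) ⬝ᵥ w l)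
      (b := b - D.F k ⬝ᵥ P.z i.succ)
      (fun m => ⟨D.sampleAt i m, hmem m, by simpa using hε.le⟩)
      (fun w hw => by
        have hamb : ∀ m, (⟨empirical (w m), inferInstance⟩ : ProbabilityMeasure (Fin nx → ℝ))
            ∈ D.ambiguity i m := fun m => empirical_mem_wassersteinBall (hw m).1 (hw m).2
        have := (hval _ hamb).symm.trans_le (hle _ hamb)
        simp only [ProbabilityMeasure.coe_mk, integral_empirical] at this
        linarith)
    choose r s γ hr hrs hγ using fun m =>
      exists_dual_of_transport_le hM (hmem m) hε fun w hw hd => hV m w ⟨hw, hd⟩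
    exact ⟨r, s, γ, (Finset.sum_le_sum fun m _ => hrs m).trans hsum, fun m l =>
      ⟨(hγ m l).1, (dualNorm_le_iff hnrm _ _).2 ⟨hr m, (hγ m l).2.1⟩, (hγ m l).2.2⟩⟩
  · rintro ⟨r, s, γ, hsum, hγ⟩ ℙ hℙ
    rw [hval ℙ hℙ]
    have hm : ∀ m, ∫ w, (D.F k ᵥ* D.transition P i m) ⬝ᵥ w ∂(ℙ m : Measure (Fin nx → ℝ))
        ≤ r m * D.ε + (1 / (M : ℝ)) * ∑ l, s m l := fun m => by
      have hdual := fun l => (dualNorm_le_iff hnrm _ _).1 (hγ m l).2.1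
      -- The reformulation does not impose `0 ≤ r m`; it follows from the dual norm bound at any one
      -- sample, here index `0`.
      exact integral_le_of_mem_wassersteinBall hM hnrm ⟨_, hmem m ⟨0, hM⟩⟩ hε (hℙ m)
        (hdual ⟨0, hM⟩).1 fun l w hw =>
          dotProduct_le_of_dual hw (hγ m l).2.2 (hγ m l).1 (hdual l).2
    have := (Finset.sum_le_sum fun m (_ : m ∈ Finset.univ) => hm m).trans hsum
    linarith

theorem feasible_eq_image (hM : 0 < M) (hnrm : ∀ x, D.nrm x = 0 → x = 0) (hε : 0 < D.ε)
    (hsample : ∀ m l, D.sample m l ∈ polyhedron D.H D.h) :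
    D.feasible = Prod.fst '' D.reformulated := by
  ext P
  constructor
  · rintro ⟨hP, hwc⟩
    choose lam s γ h using fun i k =>
      (D.worstCase_le_iff hM hnrm hε hsample P i k (D.f k)).1 (hwc i k)
    exact ⟨(P, ⟨lam, s, γ⟩), ⟨hP, h⟩, rfl⟩
  · rintro ⟨⟨P, Y⟩, ⟨hP, h⟩, rfl⟩
    exact ⟨hP, fun i k => (D.worstCase_le_iff hM hnrm hε hsample P i k (D.f k)).2
      ⟨Y.lam i k, Y.s i k, Y.γ i k, h i k⟩⟩

end Data

/-! ### Optimization over a projection -/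

theorem optimalValue_image_fst {α β : Type*} (T : Set (α × β)) (J : α → ℝ) :
    optimalValue (Prod.fst '' T) J = optimalValue T fun X => J X.1 := by
  simp only [optimalValue, iInf_image]

theorem isOptimal_lift_iff {α β : Type*} (T : Set (α × β)) (J : α → ℝ) (x : α) (y : β) :
    IsOptimal T (fun X => J X.1) (x, y) ↔ IsOptimal (Prod.fst '' T) J x ∧ (x, y) ∈ T := by
  simp only [IsOptimal, Set.forall_mem_image]
  exact ⟨fun h => ⟨⟨⟨_, h.1, rfl⟩, h.2⟩, h.1⟩, fun h => ⟨h.2, h.1.2⟩⟩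

theorem isOptimal_image_fst_iff {α β : Type*} (T : Set (α × β)) (J : α → ℝ) (x : α) :
    IsOptimal (Prod.fst '' T) J x ↔ ∃ y, IsOptimal T (fun X => J X.1) (x, y) := by
  simp only [isOptimal_lift_iff]
  refine ⟨fun h => ?_, fun ⟨_, h, _⟩ => h⟩
  obtain ⟨⟨x', y⟩, hT, rfl⟩ := h.1
  exact ⟨y, h, hT⟩

end DRMPC

theorem proposition1 {nx nu nF nH N M : ℕ} (D : DRMPC.Data nx nu nF nH N M)
    (hM : 0 < M)
    (hdyn : Differentiable ℝ (fun q : (Fin nx → ℝ) × (Fin nu → ℝ) => D.dyn q.1 q.2))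
    (hnrm : ∀ x, D.nrm x = 0 → x = 0)
    (hε : 0 < D.ε)
    (hsample : ∀ m l, D.sample m l ∈ DRMPC.polyhedron D.H D.h) :
    D.feasible = Prod.fst '' D.reformulated ∧
    DRMPC.optimalValue D.feasible D.cost
      = DRMPC.optimalValue D.reformulated (fun X => D.cost X.1) ∧
    (∀ P : DRMPC.Plan nx nu N, DRMPC.IsOptimal D.feasible D.cost P ↔
      ∃ Y : DRMPC.Duals nF nH N M,
        DRMPC.IsOptimal D.reformulated (fun X => D.cost X.1) (P, Y)) ∧
    (∀ (P : DRMPC.Plan nx nu N) (Y : DRMPC.Duals nF nH N M),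
      DRMPC.IsOptimal D.reformulated (fun X => D.cost X.1) (P, Y) ↔
        DRMPC.IsOptimal D.feasible D.cost P ∧ (P, Y) ∈ D.reformulated) := by
  rw [D.feasible_eq_image hM hnrm hε hsample]
  exact ⟨rfl, DRMPC.optimalValue_image_fst _ _, DRMPC.isOptimal_image_fst_iff _ _,
    DRMPC.isOptimal_lift_iff _ _⟩
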